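/- Let $G$ be a topologically principal étale groupoid. Here an étale groupoid is a locally compact Hausdorff topological groupoid (not assumed second countable) whose domain map $d\colon G\to G^{(0)}$ is a local homeomorphism, $r$ denotes the range map, and topologically principal means that $\{x\in G^{(0)} : d^{-1}(x)\cap r^{-1}(x)=\{x\}\}$ is dense in the unit space $G^{(0)}$. Let $C^*_r(G)$ be the reduced groupoid C*-algebra of $G$, with its canonical subalgebra $C_0(G^{(0)})\subset C^*_r(G)$, the closure of $C_c(G^{(0)})\subset C_c(G)$. Let $H$ be a topological group and let $\sigma\colon H\to \operatorname{Aut}(C^*_r(G))$ be an action of $H$ by $*$-automorphisms, that is, a group homomorphism (no continuity of $\sigma$ is assumed), such that \[\ker\sigma=\{s\in H : \sigma_s=\mathrm{id}_{C^*_r(G)}\}\] is closed in $H$. Assume that the fixed-point algebra \[C^*_r(G)^{\sigma}=\bigcap_{s\in H}\{x\in C^*_r(G) : \sigma_s(x)=x\}\] contains $C_0(G^{(0)})$. Let $H^{\mathrm{ab}}=H/\overline{[H,H]}$ be the quotient of $H$ by the closure of its commutator subgroup, with quotient map $\pi\colon H\to H^{\mathrm{ab}}$. Then there exists an action $\widetilde{\sigma}\colon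 H^{\mathrm{ab}}\to\operatorname{Aut}(C^*_r(G))$ such that $\sigma_s=\widetilde{\sigma}_{\pi(s)}$ for all $s\in H$. -/

import Mathlib

open scoped ENNReal CompactlySupported
universe u v

/-- A matrix over `ℂ` with at most `n` non-zero entries in every row and column, all of them bounded by `C`. -/
structure IsBandMatrix {ι : Type u} (a : ι → ι → ℂ) (n : ℕ) (C : ℝ) : Prop where
  row : ∀ i, ∃ s : Finset ι, s.card ≤ n ∧ ∀ j, a i j ≠ 0 → j ∈ s
  col : ∀ j, ∃ s : Finset ι, s.card ≤ n ∧ ∀ i, a i j ≠ 0 → i ∈ s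
  bound : ∀ i j, ‖a i j‖ ≤ C

abbrev EllTwo (ι : Type u) : Type u := lp (fun _ : ι => ℂ) 2

theorem IsBandMatrix.summable {ι : Type u} {a : ι → ι → ℂ} {n : ℕ} {C : ℝ}
    (h : IsBandMatrix a n C) (i : ι) (ξ : ι → ℂ) : Summable fun j => a i j * ξ j := by
  obtain ⟨s, -, hs⟩ := h.row i
  refine summable_of_ne_finset_zero (s := s) fun j hj => ?_
  by_contra hne
  exact hj (hs j fun h0 => hne (by simp [h0]))

theorem IsBandMatrix.sum_le {ι : Type u} {a : ι → ι → ℂ} {n : ℕ} {C : ℝ}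
    (h : IsBandMatrix a n C) (ξ : EllTwo ι) (t : Finset ι) :
    ∑ i ∈ t, ‖∑' j, a i j * ξ j‖ ^ 2 ≤ (n * C * ‖ξ‖) ^ 2 := by
  classical
  choose s hs hs' using h.row
  choose q hq hq' using h.col
  set S := t.biUnion s with hS
  have h1 : ∀ i ∈ t, ‖∑' j, a i j * ξ j‖ ^ 2 ≤
      ∑ j ∈ S, n * C ^ 2 * ((if a i j ≠ 0 then 1 else 0) * ‖ξ j‖ ^ 2) := by
    intro i hi
    rw [tsum_eq_sum (s := s i) (fun j hj => by
      by_contra hne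
      exact hj (hs' i j fun h0 => hne (by simp [h0])))]
    calc ‖∑ j ∈ s i, a i j * ξ j‖ ^ 2 ≤ (∑ j ∈ s i, ‖a i j * ξ j‖) ^ 2 := by
          gcongr; exact norm_sum_le _ _
      _ ≤ (s i).card * ∑ j ∈ s i, ‖a i j * ξ j‖ ^ 2 := sq_sum_le_card_mul_sum_sq
      _ ≤ n * ∑ j ∈ s i, ‖a i j * ξ j‖ ^ 2 := by
          gcongr; exact_mod_cast hs i
      _ ≤ n * ∑ j ∈ S, ‖a i j * ξ j‖ ^ 2 := by
          gcongr
          exact Finset.subset_biUnion_of_mem s hi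
      _ ≤ _ := by
          rw [Finset.mul_sum]
          refine Finset.sum_le_sum fun j _ => ?_
          by_cases h0 : a i j = 0
          · simp [h0]
          · rw [if_pos h0, norm_mul, mul_pow, one_mul, ← mul_assoc]
            have := h.bound i j
            gcongr
  have h2 : ∑ j ∈ S, ‖ξ j‖ ^ 2 ≤ ‖ξ‖ ^ 2 := by
    have := lp.sum_rpow_le_norm_rpow (p := 2) (by norm_num) ξ S
    simpa using this
  calc _ ≤ ∑ i ∈ t, ∑ j ∈ S, n * C ^ 2 * ((if a i j ≠ 0 then 1 else 0) * ‖ξ j‖ ^ 2) :=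
        Finset.sum_le_sum h1
    _ = ∑ j ∈ S, n * C ^ 2 * ((∑ i ∈ t, if a i j ≠ 0 then 1 else 0) * ‖ξ j‖ ^ 2) := by
        rw [Finset.sum_comm]
        refine Finset.sum_congr rfl fun j _ => ?_
        rw [Finset.sum_mul, Finset.mul_sum]
    _ ≤ ∑ j ∈ S, n * C ^ 2 * (n * ‖ξ j‖ ^ 2) := by
        gcongr with j _
        rw [Finset.sum_boole]
        have : (t.filter fun i => a i j ≠ 0).card ≤ n :=
          (Finset.card_le_card fun i hi => hq' j i (by simpa using (Finset.mem_filter.1 hi).2)).trans (hq j)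
        exact_mod_cast this
    _ = (n * C) ^ 2 * ∑ j ∈ S, ‖ξ j‖ ^ 2 := by
        rw [Finset.mul_sum]
        refine Finset.sum_congr rfl fun j _ => ?_
        ring
    _ ≤ (n * C) ^ 2 * ‖ξ‖ ^ 2 := by gcongr
    _ = _ := by ring

theorem IsBandMatrix.memℓp {ι : Type u} {a : ι → ι → ℂ} {n : ℕ} {C : ℝ}
    (h : IsBandMatrix a n C) (ξ : EllTwo ι) :
    Memℓp (fun i => ∑' j, a i j * ξ j) 2 :=
  memℓp_gen' (C := (n * C * ‖ξ‖) ^ 2) fun t => by simpa using h.sum_le ξ t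

/-- The bounded operator on `ℓ²(ι)` given by a matrix as above:
`(a ξ)(i) = ∑ j, a i j * ξ j`. -/
noncomputable def matrixOperator {ι : Type u} (a : ι → ι → ℂ)
    (h : ∃ n C, 0 ≤ C ∧ IsBandMatrix a n C) : EllTwo ι →L[ℂ] EllTwo ι :=
  LinearMap.mkContinuousOfExistsBound
    { toFun := fun ξ => ⟨fun i => ∑' j, a i j * ξ j, by
        obtain ⟨n, C, -, h⟩ := h
        exact h.memℓp ξ⟩
      map_add' := fun ξ η => by
        obtain ⟨n, C, -, h⟩ := h
        ext i
        simp only [lp.coeFn_add, Pi.add_apply, mul_add]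
        exact (h.summable i _).tsum_add (h.summable i _)
      map_smul' := fun c ξ => by
        ext i
        simp only [lp.coeFn_smul, Pi.smul_apply, smul_eq_mul, RingHom.id_apply, ← tsum_mul_left]
        exact tsum_congr fun j => by ring }
    (by
      obtain ⟨n, C, hC, h⟩ := h
      refine ⟨n * C, fun ξ => ?_⟩
      refine lp.norm_le_of_forall_sum_le (p := 2) (by norm_num) (by positivity) fun t => ?_
      simpa using h.sum_le ξ t)

theorem matrixOperator_apply {ι : Type u} (a : ι → ι → ℂ)
    (h : ∃ n C, 0 ≤ C ∧ IsBandMatrix a n C) (ξ : EllTwo ι) (i : ι) :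
    matrixOperator a h ξ i = ∑' j, a i j * ξ j := rfl

theorem matrixOperator_norm_le {ι : Type u} {a : ι → ι → ℂ}
    {n : ℕ} {C : ℝ} (hC : 0 ≤ C) (h : IsBandMatrix a n C) :
    ‖matrixOperator a ⟨n, C, hC, h⟩‖ ≤ n * C := by
  refine ContinuousLinearMap.opNorm_le_bound _ (by positivity) fun ξ => ?_
  refine lp.norm_le_of_forall_sum_le (p := 2) (by norm_num) (by positivity) fun t => ?_
  simpa [matrixOperator_apply] using h.sum_le ξ t

theorem matrixOperator_single {ι : Type u} [DecidableEq ι] (a : ι → ι → ℂ)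
    (h : ∃ n C, 0 ≤ C ∧ IsBandMatrix a n C) (i j : ι) :
    matrixOperator a h (lp.single 2 j 1) i = a i j := by
  rw [matrixOperator_apply, tsum_eq_single j]
  · simp
  · intro k hk
    simp [hk]

theorem operator_ext {ι : Type u} [DecidableEq ι] {S T : EllTwo ι →L[ℂ] EllTwo ι}
    (h : ∀ i j, S (lp.single 2 j 1) i = T (lp.single 2 j 1) i) : S = T := by
  refine lp.ext_continuousLinearMap (by norm_num) fun j => ?_
  ext i
  simpa using h i j

/-- A groupoid on a set `G` of arrows, with unit space `G⁽⁰⁾ = units`, domain and range maps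
`d, r : G → G⁽⁰⁾`, product `mul α β` defined exactly when `d α = r β`, and inverse. -/
class ArrowGroupoid (G : Type u) where
  units : Set G
  d : G → units
  r : G → units
  mul : ∀ α β : G, d α = r β → G
  inv : G → G
  d_unit : ∀ x : units, d x = x
  r_unit : ∀ x : units, r x = x
  mul_d : ∀ α : G, mul α (d α) (r_unit (d α)).symm = α
  r_mul_self : ∀ α : G, mul (r α) α (d_unit (r α)) = α
  d_mul : ∀ α β h, d (mul α β h) = d β
  r_mul : ∀ α β h, r (mul α β h) = r α
  assoc : ∀ α β γ (h : d α = r β) (h' : d β = r γ),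
    mul (mul α β h) γ ((d_mul α β h).trans h') = mul α (mul β γ h') (h.trans (r_mul β γ h').symm)
  d_inv : ∀ α, d (inv α) = r α
  r_inv : ∀ α, r (inv α) = d α
  inv_mul_eq : ∀ α, mul (inv α) α (d_inv α) = d α
  mul_inv_eq : ∀ α, mul α (inv α) (r_inv α).symm = r α

namespace ArrowGroupoid

variable {G : Type u} [ArrowGroupoid G]

/-- The unit space `G⁽⁰⁾` as a type (with the subspace topology if `G` is a space). -/
abbrev UnitSpace (G : Type u) [ArrowGroupoid G] : Type u := (units : Set G)

/-- The fibre `G_x = d⁻¹(x)`. -/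
abbrev Fiber (x : UnitSpace G) : Type u := {γ : G // d γ = x}

/-- `γ β⁻¹`, for arrows with the same domain. -/
def div (γ β : G) (h : d γ = d β) : G := mul γ (inv β) (h.trans (r_inv β).symm)

theorem mul_congr {α α' β β' : G} (h : d α = r β) (hα : α = α') (hβ : β = β') :
    mul α β h = mul α' β' (hα ▸ hβ ▸ h) := by subst hα hβ; rfl

theorem d_div (γ β : G) (h : d γ = d β) : d (div γ β h) = r β := by
  rw [div, d_mul, d_inv]

theorem r_div (γ β : G) (h : d γ = d β) : r (div γ β h) = r γ := by
  rw [div, r_mul]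

theorem div_mul_eq (γ β : G) (h : d γ = d β) : mul (div γ β h) β (d_div γ β h) = γ := by
  unfold div
  rw [assoc _ _ _ _ (d_inv β)]
  rw [mul_congr _ rfl (inv_mul_eq β)]
  rw [mul_congr _ rfl (congrArg Subtype.val h.symm)]
  exact mul_d γ

theorem mul_div_eq (α β : G) (h : d α = r β) : div (mul α β h) β (d_mul α β h) = α := by
  unfold div
  rw [assoc _ _ _ h (r_inv β).symm]
  rw [mul_congr _ rfl (mul_inv_eq β)]
  rw [mul_congr _ rfl (congrArg Subtype.val h.symm)]
  exact mul_d α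

theorem right_cancel {α α' β : G} (h : d α = r β) (h' : d α' = r β)
    (e : mul α β h = mul α' β h') : α = α' := by
  rw [← mul_div_eq α β h, ← mul_div_eq α' β h']
  congr 1

theorem div_self_eq (γ : G) : div γ γ rfl = r γ := mul_inv_eq γ

theorem div_unit (γ : G) : div γ (d γ) (d_unit _).symm = γ := by
  have := div_mul_eq γ (d γ) (d_unit _).symm
  have h2 := mul_d (div γ (d γ) (d_unit (d γ)).symm)
  have h3 : d (div γ (d γ) (d_unit (d γ)).symm) = d γ := by rw [d_div, r_unit]
  rw [mul_congr _ rfl (congrArg Subtype.val h3)] at h2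
  exact h2.symm.trans this

/-- `(γ β⁻¹)(β δ⁻¹) = γ δ⁻¹` -/
theorem div_comp_div (γ β δ : G) (h : d γ = d β) (h' : d β = d δ) :
    mul (div γ β h) (div β δ h') ((d_div γ β h).trans (r_div β δ h').symm)
      = div γ δ (h.trans h') := by
  have h1 : d (div γ β h) = r β := d_div γ β h
  conv_lhs => unfold div
  have := assoc (div γ β h) β (inv δ) h1 (h'.trans (r_inv δ).symm)
  unfold div at this ⊢
  rw [← this]
  exact mul_congr _ (div_mul_eq γ β h) rfl

/-- `(γ β⁻¹)⁻¹ = β γ⁻¹` -/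
theorem inv_div_eq (γ β : G) (h : d γ = d β) : inv (div γ β h) = div β γ h.symm := by
  have h1 := div_comp_div β γ β h.symm h
  refine right_cancel (β := div γ β h) (d_inv _) ?_ ?_
  · rw [d_div, r_div]
  · rw [inv_mul_eq, h1, div_self_eq, d_div]

theorem inv_inv_eq (α : G) : inv (inv α) = α := by
  refine right_cancel (β := inv α) (d_inv _) (r_inv α).symm ?_
  rw [inv_mul_eq, mul_inv_eq, d_inv]

/-- The set of factorizations `αβ = γ`. -/
abbrev Factorization (γ : G) : Type u := {p : G × G // ∃ h : d p.1 = r p.2, mul p.1 p.2 h = γ}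

/-- The factorizations of `γ δ⁻¹` are the pairs `(γ β⁻¹, β δ⁻¹)`. -/
def factorizationEquiv (γ δ : G) (h : d γ = d δ) :
    Fiber (d δ) ≃ Factorization (div γ δ h) where
  toFun β := ⟨(div γ β (h.trans β.2.symm), div β δ β.2),
    (d_div γ β.1 (h.trans β.2.symm)).trans (r_div β.1 δ β.2).symm,
    div_comp_div γ β.1 δ (h.trans β.2.symm) β.2⟩
  invFun p := ⟨mul p.1.2 δ (by
      obtain ⟨h1, h2⟩ := p.2
      rw [← d_mul _ _ h1, h2, d_div]), d_mul _ _ _⟩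
  left_inv β := by
    ext
    exact div_mul_eq β.1 δ β.2
  right_inv p := by
    obtain ⟨⟨α, β⟩, h1, h2⟩ := p
    have hβ : d β = r δ := by
      rw [← d_mul _ _ h1, h2, d_div]
    have h3 : mul α (mul β δ hβ) (h1.trans (r_mul _ _ _).symm) = γ := by
      rw [← assoc _ _ _ h1 hβ, mul_congr _ h2 rfl]
      exact div_mul_eq _ _ _
    ext
    · show div γ (mul β δ hβ) (by rw [h.trans (d_mul _ _ _).symm]) = α
      have := mul_div_eq α (mul β δ hβ) (h1.trans (r_mul _ _ _).symm)
      rw [← this]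
      congr 1
      exact h3.symm
    · exact mul_div_eq _ _ _

end ArrowGroupoid

section
open ArrowGroupoid

/-- An étale groupoid: product and inverse are continuous, and the domain map `G → G⁽⁰⁾` is a
local homeomorphism. -/
class EtaleGroupoid (G : Type u) [TopologicalSpace G] extends ArrowGroupoid G where
  continuous_mul : Continuous fun p : {p : G × G // d p.1 = r p.2} => mul p.1.1 p.1.2 p.2
  continuous_inv : Continuous (inv : G → G)
  isLocalHomeomorph_d : IsLocalHomeomorph d

namespace EtaleGroupoid

/-- The set of `x ∈ G⁽⁰⁾` with trivial isotropy, `G_x ∩ G^x = {x}`, is dense in `G⁽⁰⁾`. -/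
def IsTopologicallyPrincipal (G : Type u) [TopologicalSpace G] [EtaleGroupoid G] : Prop :=
  Dense {x : UnitSpace G | {γ : G | d γ = x} ∩ {γ : G | r γ = x} = {(x : G)}}

variable {G : Type u} [TopologicalSpace G] [EtaleGroupoid G]

theorem continuous_d : Continuous (d : G → UnitSpace G) := isLocalHomeomorph_d.continuous

theorem r_eq : (r : G → UnitSpace G) = d ∘ inv := funext fun γ => (d_inv γ).symm

theorem continuous_r : Continuous (r : G → UnitSpace G) := by
  rw [r_eq]; exact continuous_d.comp continuous_inv

theorem continuous_div {X : Type*} [TopologicalSpace X] {φ ψ : X → G}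
    (hφ : Continuous φ) (hψ : Continuous ψ) (h : ∀ x, d (φ x) = d (ψ x)) :
    Continuous fun x => div (φ x) (ψ x) (h x) := by
  have : Continuous fun x => (⟨(φ x, inv (ψ x)), (h x).trans (r_inv _).symm⟩ :
      {p : G × G // d p.1 = r p.2}) :=
    (hφ.prodMk (continuous_inv.comp hψ)).subtype_mk _
  exact continuous_mul.comp this

/-- The product and the inverse are continuous, and the domain map is a local homeomorphism, so
the open sets on which `d` and `r` are injective form a cover. -/
theorem exists_open_bisection (γ : G) :
    ∃ U : Set G, IsOpen U ∧ γ ∈ U ∧ Set.InjOn (d : G → UnitSpace G) U ∧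
      Set.InjOn (r : G → UnitSpace G) U := by
  obtain ⟨e, he, hd⟩ := isLocalHomeomorph_d (G := G) γ
  obtain ⟨e', he', hd'⟩ := isLocalHomeomorph_d (G := G) (inv γ)
  refine ⟨e.source ∩ inv ⁻¹' e'.source, e.open_source.inter (e'.open_source.preimage continuous_inv),
    ⟨he, he'⟩, ?_, ?_⟩
  · rw [hd]; exact e.injOn.mono Set.inter_subset_left
  · rw [r_eq, hd']
    intro a ha b hb hab
    have := e'.injOn ha.2 hb.2 hab
    rw [← inv_inv_eq a, this, inv_inv_eq]

theorem exists_bisection_cover {K : Set G} (hK : IsCompact K) :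
    ∃ (n : ℕ) (U : Fin n → Set G), (∀ i, IsOpen (U i)) ∧ (∀ i, Set.InjOn (d : G → UnitSpace G) (U i)) ∧
      (∀ i, Set.InjOn (r : G → UnitSpace G) (U i)) ∧ K ⊆ ⋃ i, U i := by
  choose U hU hmem hd hr using exists_open_bisection (G := G)
  obtain ⟨t, ht⟩ := hK.elim_finite_subcover U hU fun γ _ => Set.mem_iUnion.2 ⟨γ, hmem γ⟩
  refine ⟨t.card, fun i => U (t.equivFin.symm i), fun _ => hU _, fun _ => hd _, fun _ => hr _, ?_⟩
  intro γ hγ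
  obtain ⟨β, hβ, h⟩ := Set.mem_iUnion₂.1 (ht hγ)
  exact Set.mem_iUnion.2 ⟨t.equivFin ⟨β, hβ⟩, by simpa using h⟩

/-- A compact set meets the fibres of `d` and of `r` in boundedly many points. -/
theorem exists_card_le {K : Set G} (hK : IsCompact K) :
    ∃ n : ℕ, (∀ x : UnitSpace G, ∃ s : Finset G, s.card ≤ n ∧ ∀ γ ∈ K, d γ = x → γ ∈ s) ∧
      (∀ x : UnitSpace G, ∃ s : Finset G, s.card ≤ n ∧ ∀ γ ∈ K, r γ = x → γ ∈ s) := by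
  classical
  obtain ⟨n, U, -, hd, hr, hKU⟩ := exists_bisection_cover hK
  have key : ∀ p : G → UnitSpace G, (∀ i, Set.InjOn p (U i)) → ∀ x,
      ∃ s : Finset G, s.card ≤ n ∧ ∀ γ ∈ K, p γ = x → γ ∈ s := by
    intro p hp x
    have hsub : ∀ i, {γ | γ ∈ U i ∧ p γ = x}.Subsingleton := fun i a ha b hb =>
      hp i ha.1 hb.1 (ha.2.trans hb.2.symm)
    refine ⟨Finset.univ.biUnion fun i => (hsub i).finite.toFinset, ?_, ?_⟩
    · refine Finset.card_biUnion_le.trans ?_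
      calc _ ≤ ∑ i : Fin n, 1 := Finset.sum_le_sum fun i _ => by
            rw [Finset.card_le_one]
            intro a ha b hb
            exact hsub i (by simpa using ha) (by simpa using hb)
        _ = n := by simp
    · intro γ hγ hx
      obtain ⟨i, hi⟩ := Set.mem_iUnion.1 (hKU hγ)
      simp only [Finset.mem_biUnion, Finset.mem_univ, true_and, Set.Finite.mem_toFinset]
      exact ⟨i, hi, hx⟩
  exact ⟨n, key d hd, key r hr⟩

theorem continuous_sum_of_bisection [T2Space G] {f k : G → ℂ} (hf : Continuous f)
    (hk : Continuous k) (hkc : HasCompactSupport k) {U : Set G} (hU : IsOpen U)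
    (hkU : tsupport k ⊆ U) (hd : Set.InjOn (d : G → UnitSpace G) U) :
    Continuous fun γ : G => ∑' β : Fiber (d γ), f (div γ β β.2.symm) * k β := by
  have hdU : Topology.IsOpenEmbedding fun β : U => (d (β : G) : UnitSpace G) :=
    .of_continuous_injective_isOpenMap (continuous_d.comp continuous_subtype_val)
      (Set.injOn_iff_injective.1 hd)
      (isLocalHomeomorph_d.isOpenMap.comp hU.isOpenMap_subtype_val)
  rw [continuous_iff_continuousAt]
  intro γ₀
  by_cases h0 : d γ₀ ∈ (d : G → UnitSpace G) '' U
  · have hW : IsOpen {γ : G | d γ ∈ (d : G → UnitSpace G) '' U} :=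
      (isLocalHomeomorph_d.isOpenMap _ hU).preimage continuous_d
    refine ContinuousOn.continuousAt (s := {γ : G | d γ ∈ (d : G → UnitSpace G) '' U}) ?_
      (hW.mem_nhds h0)
    rw [continuousOn_iff_continuous_domRestrict]
    let e := hdU.toIsEmbedding.toHomeomorph
    have hmem : ∀ γ : {γ : G | d γ ∈ (d : G → UnitSpace G) '' U},
        d (γ : G) ∈ Set.range fun β : U => (d (β : G) : UnitSpace G) := fun γ => by
      obtain ⟨β, hβ, h⟩ := γ.2
      exact ⟨⟨β, hβ⟩, h⟩
    let s : {γ : G | d γ ∈ (d : G → UnitSpace G) '' U} → U := fun γ => e.symm ⟨d (γ : G), hmem γ⟩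
    have hs : Continuous s :=
      e.symm.continuous.comp ((continuous_d.comp continuous_subtype_val).subtype_mk _)
    have hds : ∀ γ, d (s γ : G) = d (γ : G) := fun γ =>
      congrArg Subtype.val (e.apply_symm_apply ⟨d (γ : G), hmem γ⟩)
    have heq : ∀ γ : {γ : G | d γ ∈ (d : G → UnitSpace G) '' U},
        ∑' β : Fiber (d (γ : G)), f (div γ β β.2.symm) * k β
          = f (div γ (s γ) (hds γ).symm) * k (s γ) := by
      intro γ
      rw [tsum_eq_single ⟨(s γ : G), hds γ⟩]
      intro β hβ
      have : k β = 0 := by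
        by_contra hne
        refine hβ (Subtype.ext (hd (hkU (subset_tsupport k hne)) (s γ).2 ?_))
        rw [hds γ, β.2]
      rw [this, mul_zero]
    refine Continuous.congr ?_ fun γ => (heq γ).symm
    have hs' : Continuous fun γ => (s γ : G) := continuous_subtype_val.comp hs
    exact (hf.comp (continuous_div continuous_subtype_val hs' fun γ => (hds γ).symm)).mul
      (hk.comp hs')
  · have hL : IsClosed ((d : G → UnitSpace G) '' tsupport k) :=
      (hkc.isCompact.image continuous_d).isClosed
    have hW : IsOpen {γ : G | d γ ∉ (d : G → UnitSpace G) '' tsupport k} :=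
      hL.isOpen_compl.preimage continuous_d
    have h1 : γ₀ ∈ {γ : G | d γ ∉ (d : G → UnitSpace G) '' tsupport k} :=
      fun h => h0 (Set.image_mono hkU h)
    refine (continuousAt_const (y := (0 : ℂ))).congr ?_
    filter_upwards [hW.mem_nhds h1] with γ hγ
    symm
    convert tsum_zero with β
    have : k β = 0 := by
      by_contra hne
      exact hγ ⟨β, subset_tsupport k hne, β.2⟩
    rw [this, mul_zero]

theorem summable_fiber (k : C_c(G, ℂ)) (x : UnitSpace G) (c : Fiber x → ℂ) :
    Summable fun β : Fiber x => c β * k β := by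
  obtain ⟨n, h, -⟩ := exists_card_le k.hasCompactSupport.isCompact
  obtain ⟨s, -, hs⟩ := h x
  refine summable_of_hasFiniteSupport
    ((s.finite_toSet.preimage Subtype.val_injective.injOn).subset fun β hβ => ?_)
  refine hs β (subset_tsupport k fun h0 => hβ ?_) β.2
  simp [h0]

/-- The value of the convolution, `(f * g)(γ) = ∑_{αβ = γ} f(α) g(β)`. -/
noncomputable def convolutionFun (f g : G → ℂ) (γ : G) : ℂ :=
  ∑' p : Factorization γ, f p.1.1 * g p.1.2

theorem convolutionFun_div (f g : G → ℂ) (γ δ : G) (h : d γ = d δ) :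
    convolutionFun f g (div γ δ h) =
      ∑' β : Fiber (d δ), f (div γ β (h.trans β.2.symm)) * g (div β δ β.2) :=
  ((factorizationEquiv γ δ h).tsum_eq
    (fun p : Factorization (div γ δ h) => f p.1.1 * g p.1.2)).symm

theorem convolutionFun_eq (f g : G → ℂ) (γ : G) :
    convolutionFun f g γ = ∑' β : Fiber (d γ), f (div γ β β.2.symm) * g β := by
  have key : ∀ (x : UnitSpace G) (hx : d γ = d (x : G)) (hx' : d (x : G) = x),
      convolutionFun f g (div γ x hx) = ∑' β : Fiber x, f (div γ β ((hx.trans hx').trans β.2.symm)) * g β := by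
    intro x hx hx'
    rw [convolutionFun_div]
    have hβ : ∀ β : G, ∀ h : d β = d (x : G), div β x h = β := by
      intro β h
      obtain rfl : x = d β := (hx'.symm.trans h.symm)
      exact div_unit β
    simp only [hβ]
    have : ∀ y : UnitSpace G, ∀ e : y = x, ∀ h' : d γ = y,
        ∑' β : Fiber y, f (div γ β (h'.trans β.2.symm)) * g β =
        ∑' β : Fiber x, f (div γ β ((h'.trans e).trans β.2.symm)) * g β := by
      rintro y rfl h'
      rfl
    exact this _ hx' hx
  rw [← key (d γ) (d_unit _).symm (d_unit _), div_unit]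

theorem exists_isBandMatrix (f : C_c(G, ℂ)) : ∃ (n : ℕ) (C : ℝ), 0 ≤ C ∧ ∀ x : UnitSpace G,
    IsBandMatrix (fun γ β : Fiber x => f (div (γ : G) β (γ.2.trans β.2.symm))) n C := by
  classical
  obtain ⟨n, hd, hr⟩ := exists_card_le f.hasCompactSupport.isCompact
  obtain ⟨C, hC⟩ := f.hasCompactSupport.exists_bound_of_continuous f.continuous
  refine ⟨n, max C 0, le_max_right _ _, fun x => ⟨fun γ => ?_, fun β => ?_, fun γ β =>
    (hC _).trans (le_max_left _ _)⟩⟩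
  · obtain ⟨s, hs, h⟩ := hr (r (γ : G))
    have hinj : Function.Injective fun β : Fiber x => div (γ : G) β (γ.2.trans β.2.symm) := by
      intro β β' e
      have e' := congrArg inv e
      simp only [inv_div_eq] at e'
      ext
      rw [← div_mul_eq β.1 γ (β.2.trans γ.2.symm), ← div_mul_eq β'.1 γ (β'.2.trans γ.2.symm)]
      exact mul_congr _ e' rfl
    refine ⟨s.preimage _ hinj.injOn, ?_, fun β hβ => ?_⟩
    · exact (Finset.card_le_card_of_injOn _ (fun β hβ => Finset.mem_preimage.1 hβ)
        hinj.injOn).trans hs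
    · exact Finset.mem_preimage.2 (h _ (subset_tsupport f hβ) (r_div _ _ _))
  · obtain ⟨s, hs, h⟩ := hd (r (β : G))
    have hinj : Function.Injective fun γ : Fiber x => div (γ : G) β (γ.2.trans β.2.symm) := by
      intro γ γ' e
      ext
      rw [← div_mul_eq γ.1 β (γ.2.trans β.2.symm), ← div_mul_eq γ'.1 β (γ'.2.trans β.2.symm)]
      exact mul_congr _ e rfl
    refine ⟨s.preimage _ hinj.injOn, ?_, fun γ hγ => ?_⟩
    · exact (Finset.card_le_card_of_injOn _ (fun γ hγ => Finset.mem_preimage.1 hγ)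
        hinj.injOn).trans hs
    · exact Finset.mem_preimage.2 (h _ (subset_tsupport f hγ) (d_div _ _ _))

/-- The left regular representation `λ_x(f)` on `ℓ²(G_x)`, with matrix entries
`⟨δ_γ, λ_x(f) δ_β⟩ = f(γ β⁻¹)`; that is, `λ_x(f) δ_β = ∑_{α ∈ G_{r(β)}} f(α) δ_{αβ}`. -/
noncomputable def leftRegular (x : UnitSpace G) (f : C_c(G, ℂ)) :
    EllTwo (Fiber x) →L[ℂ] EllTwo (Fiber x) :=
  matrixOperator (fun γ β : Fiber x => f (div (γ : G) β (γ.2.trans β.2.symm))) <| by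
    obtain ⟨n, C, hC, h⟩ := exists_isBandMatrix f
    exact ⟨n, C, hC, h x⟩

theorem leftRegular_apply (x : UnitSpace G) (f : C_c(G, ℂ)) (ξ : EllTwo (Fiber x)) (γ : Fiber x) :
    leftRegular x f ξ γ = ∑' β : Fiber x, f (div (γ : G) β (γ.2.trans β.2.symm)) * ξ β := rfl

theorem leftRegular_single [DecidableEq G] (x : UnitSpace G) (f : C_c(G, ℂ)) (γ β : Fiber x) :
    leftRegular x f (lp.single 2 β 1) γ = f (div (γ : G) β (γ.2.trans β.2.symm)) :=
  matrixOperator_single _ _ _ _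

theorem leftRegular_add (x : UnitSpace G) (f g : C_c(G, ℂ)) :
    leftRegular x (f + g) = leftRegular x f + leftRegular x g := by
  classical
  refine operator_ext fun γ β => ?_
  rw [leftRegular_single]
  simp [leftRegular_single]

theorem leftRegular_smul (x : UnitSpace G) (c : ℂ) (f : C_c(G, ℂ)) :
    leftRegular x (c • f) = c • leftRegular x f := by
  classical
  refine operator_ext fun γ β => ?_
  rw [leftRegular_single]
  simp [leftRegular_single]

/-- The product `∏_x B(ℓ²(G_x))` of C⋆-algebras (bounded families), with norm
`‖T‖ = sup_x ‖T_x‖`. -/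
def RegularTarget (G : Type u) [TopologicalSpace G] [EtaleGroupoid G] : Type u :=
  lp (fun x : UnitSpace G => EllTwo (Fiber x) →L[ℂ] EllTwo (Fiber x)) ∞

noncomputable instance : NonUnitalCStarAlgebra (RegularTarget G) :=
  inferInstanceAs (NonUnitalCStarAlgebra
    (lp (fun x : UnitSpace G => EllTwo (Fiber x) →L[ℂ] EllTwo (Fiber x)) ∞))

/-- The family `(λ_x(f))_x` of all left regular representations. -/
noncomputable def regular (f : C_c(G, ℂ)) : RegularTarget G :=
  ⟨fun x => leftRegular x f, by
    obtain ⟨n, C, hC, h⟩ := exists_isBandMatrix f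
    refine memℓp_infty ⟨n * C, ?_⟩
    rintro _ ⟨x, rfl⟩
    exact matrixOperator_norm_le hC (h x)⟩

/-- The reduced norm `‖f‖_r = sup_x ‖λ_x(f)‖`. -/
noncomputable def reducedNorm (f : C_c(G, ℂ)) : ℝ := ⨆ x : UnitSpace G, ‖leftRegular x f‖

theorem norm_regular (f : C_c(G, ℂ)) : ‖regular f‖ = reducedNorm f := lp.norm_eq_ciSup _

theorem regular_injective : Function.Injective (regular : C_c(G, ℂ) → RegularTarget G) := by
  classical
  intro f g h
  ext γ
  have h1 : leftRegular (d γ) f = leftRegular (d γ) g :=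
    congrFun (congrArg Subtype.val h) (d γ)
  have h2 := congrArg (fun T => T (lp.single 2 ⟨d γ, d_unit _⟩ 1) ⟨γ, rfl⟩) h1
  simp only [leftRegular_single, div_unit] at h2
  exact h2

theorem hasCompactSupport_convolutionFun [T2Space G] (f g : C_c(G, ℂ)) :
    HasCompactSupport (convolutionFun f g) := by
  have hcl : IsClosed {p : G × G | d p.1 = r p.2} :=
    isClosed_eq (continuous_d.comp continuous_fst) (continuous_r.comp continuous_snd)
  have hK := hcl.isClosedEmbedding_subtypeVal.isCompact_preimage
    (f.hasCompactSupport.isCompact.prod g.hasCompactSupport.isCompact)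
  refine HasCompactSupport.intro (hK.image continuous_mul) fun γ hγ => ?_
  unfold convolutionFun
  convert tsum_zero with p
  obtain ⟨⟨α, β⟩, h1, h2⟩ := p
  by_contra hne
  refine hγ ⟨⟨(α, β), h1⟩, ⟨subset_tsupport f ?_, subset_tsupport g ?_⟩, h2⟩
  · exact fun h0 => hne (by simp [h0])
  · exact fun h0 => hne (by simp [h0])

/-- The involution on `C_c(G)`, `f^*(γ) = conj (f(γ⁻¹))`. -/
noncomputable def involution [T2Space G] (f : C_c(G, ℂ)) : C_c(G, ℂ) :=
  ⟨⟨fun γ => starRingEnd ℂ (f (inv γ)),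
      Complex.continuous_conj.comp (f.continuous.comp continuous_inv)⟩, by
    refine HasCompactSupport.intro (f.hasCompactSupport.isCompact.image continuous_inv)
      fun γ hγ => ?_
    have : f (inv γ) = 0 := by
      by_contra hne
      exact hγ ⟨inv γ, subset_tsupport f hne, inv_inv_eq γ⟩
    show starRingEnd ℂ (f (inv γ)) = 0
    rw [this, map_zero]⟩

theorem leftRegular_involution [T2Space G] (x : UnitSpace G) (f : C_c(G, ℂ)) :
    leftRegular x (involution f) = star (leftRegular x f) := by
  classical
  refine operator_ext fun γ β => ?_
  rw [leftRegular_single, ContinuousLinearMap.star_eq_adjoint]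
  have h1 := lp.inner_single_left (𝕜 := ℂ) γ (1 : ℂ)
    (ContinuousLinearMap.adjoint (leftRegular x f) (lp.single 2 β 1))
  rw [ContinuousLinearMap.adjoint_inner_right, lp.inner_single_right, leftRegular_single] at h1
  simp only [RCLike.inner_apply, map_one, mul_one, one_mul] at h1
  rw [← h1]
  show starRingEnd ℂ (f (inv _)) = _
  rw [inv_div_eq]

variable [T2Space G] [LocallyCompactSpace G]

theorem continuous_convolutionFun (f g : C_c(G, ℂ)) : Continuous (convolutionFun f g) := by
  obtain ⟨n, U, hU, hd, -, hK⟩ := exists_bisection_cover g.hasCompactSupport.isCompact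
  obtain ⟨φ, hφU, hφ1, -, hφc⟩ := exists_continuous_sum_one_of_isOpen_isCompact hU
    g.hasCompactSupport.isCompact hK
  let k : Fin n → C_c(G, ℂ) := fun i =>
    ⟨⟨fun γ => (φ i γ : ℂ) * g γ, by fun_prop⟩, g.hasCompactSupport.mul_left⟩
  have hk : ∀ γ, g γ = ∑ i, k i γ := by
    intro γ
    show g γ = ∑ i, (φ i γ : ℂ) * g γ
    rw [← Finset.sum_mul]
    by_cases hγ : γ ∈ tsupport g
    · have := hφ1 hγ
      simp only [Finset.sum_apply, Pi.one_apply] at this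
      rw [← Complex.ofReal_sum, this]
      simp
    · simp [image_eq_zero_of_notMem_tsupport hγ]
  have : convolutionFun f g =
      fun γ => ∑ i, ∑' β : Fiber (d γ), f (div γ β β.2.symm) * k i β := by
    ext γ
    rw [convolutionFun_eq, ← Summable.tsum_finsetSum fun i _ => summable_fiber (k i) _ _]
    refine tsum_congr fun β => ?_
    rw [hk β, Finset.mul_sum]
  rw [this]
  refine continuous_finsetSum _ fun i _ => ?_
  refine continuous_sum_of_bisection f.continuous (k i).continuous (k i).hasCompactSupport (hU i)
    (Set.Subset.trans ?_ (hφU i)) (hd i)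
  refine closure_mono fun γ hγ h0 => hγ ?_
  show (φ i γ : ℂ) * g γ = 0
  rw [h0]
  simp

/-- The convolution product on `C_c(G)`, `(f * g)(γ) = ∑_{αβ = γ} f(α) g(β)`. -/
noncomputable def convolution (f g : C_c(G, ℂ)) : C_c(G, ℂ) :=
  ⟨⟨convolutionFun f g, continuous_convolutionFun f g⟩, hasCompactSupport_convolutionFun f g⟩

theorem leftRegular_convolution (x : UnitSpace G) (f g : C_c(G, ℂ)) :
    leftRegular x (convolution f g) = leftRegular x f * leftRegular x g := by
  classical
  refine operator_ext fun γ δ => ?_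
  rw [leftRegular_single, ContinuousLinearMap.mul_def, ContinuousLinearMap.comp_apply, leftRegular_apply]
  simp only [leftRegular_single]
  obtain ⟨γ, hγ⟩ := γ
  obtain ⟨δ, rfl⟩ := δ
  exact convolutionFun_div f g γ δ hγ

/-- The image of the convolution algebra `C_c(G)` in `∏_x B(ℓ²(G_x))`, a `*`-subalgebra. -/
noncomputable def convolutionAlgebra (G : Type u) [TopologicalSpace G] [EtaleGroupoid G]
    [T2Space G] [LocallyCompactSpace G] : NonUnitalStarSubalgebra ℂ (RegularTarget G) where
  carrier := Set.range regular
  add_mem' := by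
    rintro _ _ ⟨f, rfl⟩ ⟨g, rfl⟩
    exact ⟨f + g, lp.ext (funext fun x => leftRegular_add x f g)⟩
  zero_mem' := ⟨0, lp.ext (funext fun x => by
    show leftRegular x 0 = 0
    simpa using leftRegular_smul x 0 0)⟩
  mul_mem' := by
    rintro _ _ ⟨f, rfl⟩ ⟨g, rfl⟩
    exact ⟨convolution f g, lp.ext (funext fun x => leftRegular_convolution x f g)⟩
  smul_mem' := by
    rintro c _ ⟨f, rfl⟩
    exact ⟨c • f, lp.ext (funext fun x => leftRegular_smul x c f)⟩
  star_mem' := by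
    rintro _ ⟨f, rfl⟩
    exact ⟨involution f, lp.ext (funext fun x => leftRegular_involution x f)⟩

/-- The reduced groupoid C⋆-algebra `C*_r(G)`: the completion of `C_c(G)` for the reduced norm,
realised as the closure of the isometric image of `C_c(G)` in the C⋆-algebra `∏_x B(ℓ²(G_x))`. -/
def ReducedCStarAlgebra (G : Type u) [TopologicalSpace G] [EtaleGroupoid G]
    [T2Space G] [LocallyCompactSpace G] : Type u :=
  (convolutionAlgebra G).topologicalClosure

noncomputable instance : NonUnitalCStarAlgebra (ReducedCStarAlgebra G) :=
  NonUnitalStarSubalgebra.nonUnitalCStarAlgebra (convolutionAlgebra G).topologicalClosure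
    (h_closed := (convolutionAlgebra G).isClosed_topologicalClosure)

/-- The canonical map `C_c(G) → C*_r(G)`. -/
noncomputable def ofCc (f : C_c(G, ℂ)) : ReducedCStarAlgebra G :=
  ⟨regular f, (convolutionAlgebra G).le_topologicalClosure ⟨f, rfl⟩⟩

theorem norm_ofCc (f : C_c(G, ℂ)) : ‖ofCc f‖ = reducedNorm f := norm_regular f

theorem ofCc_convolution (f g : C_c(G, ℂ)) : ofCc (convolution f g) = ofCc f * ofCc g :=
  Subtype.ext (lp.ext (funext fun x => leftRegular_convolution x f g))

theorem ofCc_involution (f : C_c(G, ℂ)) : ofCc (involution f) = star (ofCc f) :=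
  Subtype.ext (lp.ext (funext fun x => leftRegular_involution x f))

theorem denseRange_ofCc : DenseRange (ofCc : C_c(G, ℂ) → ReducedCStarAlgebra G) := by
  intro a
  refine closure_subtype.2 (closure_mono ?_ a.2)
  rintro _ ⟨f, rfl⟩
  exact ⟨ofCc f, ⟨f, rfl⟩, rfl⟩

/-- The subalgebra `C_0(G⁽⁰⁾)` of `C*_r(G)`: the closure of the image of `C_c(G⁽⁰⁾)`, regarded as
the set of functions in `C_c(G)` that vanish off `G⁽⁰⁾`. -/
def unitSpaceAlgebra (G : Type u) [TopologicalSpace G] [EtaleGroupoid G]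
    [T2Space G] [LocallyCompactSpace G] : Set (ReducedCStarAlgebra G) :=
  closure (ofCc '' {f | ∀ γ, γ ∉ (units : Set G) → f γ = 0})

end EtaleGroupoid
end

/-- The fixed-point algebra of an action of a group on a C⋆-algebra by `*`-automorphisms. -/
def fixedPointAlgebra {H : Type v} [Group H] {A : Type u} [NonUnitalCStarAlgebra A]
    (σ : H →* (A ≃⋆ₐ[ℂ] A)) : NonUnitalStarSubalgebra ℂ A where
  carrier := {a | ∀ s, σ s a = a}
  add_mem' ha hb s := by rw [map_add, ha s, hb s]
  zero_mem' s := map_zero _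
  mul_mem' ha hb s := by rw [map_mul, ha s, hb s]
  smul_mem' c a ha s := by rw [map_smul, ha s]
  star_mem' ha s := by rw [map_star, ha s]

namespace EtaleGroupoid
open ArrowGroupoid

section Coefficients

variable {G : Type u} [TopologicalSpace G] [EtaleGroupoid G]

/-! It is enough that any two automorphisms of `C*_r(G)` fixing `C_0(G⁽⁰⁾)` commute: then `ker σ`
contains every commutator, and, being closed, also the closure of the commutator subgroup, so `σ`
descends to the quotient.

Commutation holds because such automorphisms are diagonal at most arrows. Regard elements of
`C*_r(G)` as continuous functions on `G` through their coefficients. Suppose `γ` is the only arrow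
from `d γ` to `r γ`. Multiplying `k ∈ C_c(G)` on the left and right by bump functions near `r γ` and
`d γ` keeps the value at `γ`, but squeezes the support into a small bisection, where the reduced
norm is at most the sup norm; so the norm of the compression is at most `|k γ| + ε`
(`exists_norm_compression_le`). An automorphism `φ` fixing `C_0(G⁽⁰⁾)` is isometric and commutes
with the compression, whence `|φ(a)(γ)| ≤ |a(γ)|` (`norm_coeff_apply_le`). Thus `a ↦ φ(a)(γ)`
vanishes wherever `a ↦ a(γ)` does and is a scalar multiple of it.

Scalars commute, so `φψ(a)` and `ψφ(a)` agree at every such `γ`. If `d γ` has trivial isotropy then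
`γ` is of this kind, and these arrows are dense because `d` is open; continuity of coefficients
gives equality everywhere. -/

theorem isOpen_units : IsOpen (units : Set G) := by
  rw [isOpen_iff_forall_mem_open]
  intro x hx
  obtain ⟨e, he, hd⟩ := isLocalHomeomorph_d (G := G) x
  have hcont : Continuous fun γ : G => ((d γ : UnitSpace G) : G) :=
    continuous_subtype_val.comp continuous_d
  -- `γ` and `d γ` have the same domain, so they coincide as soon as both lie in a set on which `d`
  -- is injective.
  refine ⟨e.source ∩ (fun γ : G => ((d γ : UnitSpace G) : G)) ⁻¹' e.source, ?_,
    e.open_source.inter (e.open_source.preimage hcont), he, ?_⟩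
  · rintro γ ⟨h1, h2⟩
    have : γ = d γ := e.injOn h1 h2 (by rw [← hd, d_unit])
    rw [this]
    exact (d γ).2
  · simpa [d_unit ⟨x, hx⟩] using he

/-! ### Convolution by functions on the unit space, and arrows over points with trivial isotropy -/

/-- A unit equals its own domain, here `r β`, so `γ = (γβ⁻¹)β = r(β)β = β`. This collapses the
convolution sum below to a single term. -/
theorem eq_of_div_mem_units {γ β : G} (h : d γ = d β) (hu : div γ β h ∈ (units : Set G)) :
    β = γ := by
  have h2 : (r β : G) = div γ β h := by
    rw [← d_div γ β h]
    exact congrArg Subtype.val (d_unit ⟨_, hu⟩)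
  rw [← div_mul_eq γ β h, ← mul_congr (d_unit (r β)) h2 rfl, r_mul_self]

theorem convolutionFun_units_left {f : G → ℂ} (hf : ∀ γ, γ ∉ (units : Set G) → f γ = 0)
    (k : G → ℂ) (γ : G) : convolutionFun f k γ = f (r γ) * k γ := by
  rw [convolutionFun_eq, tsum_eq_single ⟨γ, rfl⟩]
  · rw [div_self_eq]
  · intro β hβ
    rw [hf _ fun hu => hβ (Subtype.ext (eq_of_div_mem_units _ hu)), zero_mul]

theorem convolutionFun_units_right {g : G → ℂ} (hg : ∀ γ, γ ∉ (units : Set G) → g γ = 0)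
    (k : G → ℂ) (γ : G) : convolutionFun k g γ = k γ * g (d γ) := by
  rw [convolutionFun_eq, tsum_eq_single ⟨d γ, d_unit _⟩]
  · rw [div_unit]
  · rintro ⟨β, h⟩ hβ
    rw [hg β fun hu => hβ (Subtype.ext ?_), mul_zero]
    have e : (⟨β, hu⟩ : UnitSpace G) = d γ := (d_unit _).symm.trans h
    exact congrArg (Subtype.val : UnitSpace G → G) e

/-- The arrow `β⁻¹γ` lies in the isotropy at `d γ`, so it is the unit `d γ`, and `γ = β(β⁻¹γ) = β`.
-/
theorem eq_of_d_eq_of_r_eq {γ : G}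
    (hγ : {β : G | d β = d γ} ∩ {β : G | r β = d γ} = {((d γ : UnitSpace G) : G)}) (β : G)
    (hd : d β = d γ) (hr : r β = r γ) : β = γ := by
  have hc : d (inv β) = r γ := by rw [d_inv, hr]
  have hmem : mul (inv β) γ hc ∈
      {β : G | d β = d γ} ∩ {β : G | r β = d γ} := by
    refine ⟨?_, ?_⟩
    · exact d_mul _ _ _
    · exact (r_mul _ _ _).trans ((r_inv _).trans hd)
  rw [hγ, Set.mem_singleton_iff] at hmem
  have h := assoc β (inv β) γ (r_inv β).symm hc
  rw [mul_congr _ (mul_inv_eq β) rfl, mul_congr _ rfl hmem,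
    mul_congr _ (congrArg Subtype.val hr) rfl, r_mul_self,
    mul_congr _ rfl (congrArg Subtype.val hd.symm), mul_d] at h
  exact h.symm

variable [T2Space G] [LocallyCompactSpace G]

/-! ### Elements of the reduced algebra as continuous functions on the groupoid -/

open Classical in
/-- The matrix entry `⟨δ_γ, a_x δ_β⟩` of an element `a` of `C*_r(G)`. -/
noncomputable def entry {x : UnitSpace G} (γ β : Fiber x) : ReducedCStarAlgebra G →L[ℂ] ℂ :=
  LinearMap.mkContinuous
    { toFun := fun a => (a.1.1 x) (lp.single 2 β 1) γ
      map_add' := fun _ _ => rfl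
      map_smul' := fun _ _ => rfl } 1 fun a => by
    calc ‖(a.1.1 x) (lp.single 2 β 1) γ‖ ≤ ‖(a.1.1 x) (lp.single 2 β 1)‖ :=
          lp.norm_apply_le_norm (by norm_num) _ _
      _ ≤ ‖a.1.1 x‖ * ‖(lp.single 2 β 1 : EllTwo (Fiber x))‖ :=
          ContinuousLinearMap.le_opNorm _ _
      _ = ‖a.1.1 x‖ := by rw [lp.norm_single (by norm_num)]; simp
      _ ≤ ‖a‖ := lp.norm_apply_le_norm (by norm_num) (show lp (fun x : UnitSpace G =>
          EllTwo (Fiber x) →L[ℂ] EllTwo (Fiber x)) ∞ from a.1) x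
      _ = 1 * ‖a‖ := (one_mul _).symm

theorem entry_ofCc {x : UnitSpace G} (γ β : Fiber x) (f : C_c(G, ℂ)) :
    entry γ β (ofCc f) = f (div (γ : G) β (γ.2.trans β.2.symm)) := by
  classical
  have := leftRegular_single x f γ β
  convert! this

theorem norm_entry_le {x : UnitSpace G} (γ β : Fiber x) (a : ReducedCStarAlgebra G) :
    ‖entry γ β a‖ ≤ ‖a‖ := by
  simpa using (entry γ β).le_of_opNorm_le (LinearMap.mkContinuous_norm_le _ zero_le_one _) a

/-- The value at `γ` of an element of `C*_r(G)`, regarded as a function on `G`. -/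
noncomputable def coeff (γ : G) : ReducedCStarAlgebra G →L[ℂ] ℂ :=
  entry (x := d γ) ⟨γ, rfl⟩ ⟨d γ, d_unit _⟩

theorem coeff_ofCc (γ : G) (f : C_c(G, ℂ)) : coeff γ (ofCc f) = f γ := by
  rw [coeff, entry_ofCc]
  exact congrArg f (div_unit γ)

theorem norm_coeff_le (γ : G) (a : ReducedCStarAlgebra G) : ‖coeff γ a‖ ≤ ‖a‖ :=
  norm_entry_le _ _ a

/-- On `C_c(G)` both sides are `f(γβ⁻¹)`; both are continuous in `a`, so the identity passes to the
closure. -/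
theorem entry_eq_coeff {x : UnitSpace G} (γ β : Fiber x) (a : ReducedCStarAlgebra G) :
    entry γ β a = coeff (div (γ : G) β (γ.2.trans β.2.symm)) a := by
  refine denseRange_ofCc.induction_on a
    (isClosed_eq (entry γ β).continuous (coeff _).continuous) fun f => ?_
  rw [entry_ofCc, coeff_ofCc]

/-- Every matrix entry of the operator family is a coefficient, and bounded operators on `ℓ²` are
determined by their entries. -/
theorem ext_coeff {a b : ReducedCStarAlgebra G} (h : ∀ γ : G, coeff γ a = coeff γ b) : a = b := by
  classical
  refine Subtype.ext (lp.ext (funext fun x => operator_ext fun γ β => ?_))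
  have := (entry_eq_coeff γ β a).trans ((h _).trans (entry_eq_coeff γ β b).symm)
  convert! this

/-- The norm dominates the sup norm of coefficients, so this function is a uniform limit of elements
of `C_c(G)`. -/
theorem continuous_coeff (a : ReducedCStarAlgebra G) : Continuous fun γ : G => coeff γ a := by
  refine continuous_of_uniform_approx_of_continuous fun V hV => ?_
  obtain ⟨ε, hε, hεV⟩ := Metric.mem_uniformity_dist.1 hV
  obtain ⟨f, hf⟩ := denseRange_ofCc.exists_dist_lt a hε
  refine ⟨f, f.continuous, fun γ => hεV ?_⟩
  rw [← coeff_ofCc, dist_eq_norm, ← map_sub]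
  exact (norm_coeff_le _ _).trans_lt (by rwa [← dist_eq_norm])

theorem coeff_mul_mul {f g : C_c(G, ℂ)} (hf : ∀ γ, γ ∉ (units : Set G) → f γ = 0)
    (hg : ∀ γ, γ ∉ (units : Set G) → g γ = 0) (a : ReducedCStarAlgebra G) (γ : G) :
    coeff γ (ofCc f * a * ofCc g) = f (r γ) * coeff γ a * g (d γ) := by
  refine denseRange_ofCc.induction_on a (isClosed_eq ?_ ?_) fun k => ?_
  · exact (coeff γ).continuous.comp ((continuous_const.mul continuous_id).mul continuous_const)
  · exact (continuous_const.mul (coeff γ).continuous).mul continuous_const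
  · rw [← ofCc_convolution, ← ofCc_convolution, coeff_ofCc, coeff_ofCc]
    exact (convolutionFun_units_right hg _ γ).trans
      (congrArg (· * g (d γ)) (convolutionFun_units_left hf k γ))

/-! ### Norm estimates for compressions to small bisections -/

/-- Injectivity of `r` and `d` on `U` leaves at most one nonzero entry in each row and each column
of every `λ_x(k)`, so the band estimate `n * C` applies with `n = 1`. -/
theorem norm_ofCc_le_of_bisection {k : C_c(G, ℂ)} {U : Set G} {C : ℝ} (hC : 0 ≤ C)
    (hd : Set.InjOn (d : G → UnitSpace G) U) (hr : Set.InjOn (r : G → UnitSpace G) U)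
    (hkU : ∀ γ, k γ ≠ 0 → γ ∈ U) (hk : ∀ γ, ‖k γ‖ ≤ C) : ‖ofCc k‖ ≤ C := by
  have hband (x : UnitSpace G) : IsBandMatrix
      (fun γ β : Fiber x => k (div (γ : G) β (γ.2.trans β.2.symm))) 1 C := by
    classical
    refine ⟨fun γ => ?_, fun β => ?_, fun γ β => hk _⟩
    · have hs : {β : Fiber x | k (div (γ : G) β (γ.2.trans β.2.symm)) ≠ 0}.Subsingleton := by
        intro β hβ β' hβ'
        have e := hr (hkU _ hβ) (hkU _ hβ') (by rw [r_div, r_div])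
        have e' := congrArg inv e
        rw [inv_div_eq, inv_div_eq] at e'
        ext
        rw [← div_mul_eq β.1 γ (β.2.trans γ.2.symm), ← div_mul_eq β'.1 γ (β'.2.trans γ.2.symm)]
        exact mul_congr _ e' rfl
      exact ⟨hs.finite.toFinset, Finset.card_le_one.2 fun a ha b hb =>
        hs (by simpa using ha) (by simpa using hb), fun β hβ => by simpa using hβ⟩
    · have hs : {γ : Fiber x | k (div (γ : G) β (γ.2.trans β.2.symm)) ≠ 0}.Subsingleton := by
        intro γ hγ γ' hγ'
        have e := hd (hkU _ hγ) (hkU _ hγ') (by rw [d_div, d_div])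
        ext
        rw [← div_mul_eq γ.1 β (γ.2.trans β.2.symm), ← div_mul_eq γ'.1 β (γ'.2.trans β.2.symm)]
        exact mul_congr _ e rfl
      exact ⟨hs.finite.toFinset, Finset.card_le_one.2 fun a ha b hb =>
        hs (by simpa using ha) (by simpa using hb), fun γ hγ => by simpa using hγ⟩
  refine lp.norm_le_of_forall_le (f := (show lp (fun x : UnitSpace G =>
    EllTwo (Fiber x) →L[ℂ] EllTwo (Fiber x)) ∞ from regular k)) hC fun x => ?_
  have := matrixOperator_norm_le hC (hband x)
  rwa [Nat.cast_one, one_mul] at this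

theorem exists_bump_units (x : UnitSpace G) {V : Set (UnitSpace G)} (hV : IsOpen V) (hx : x ∈ V) :
    ∃ f : C_c(G, ℂ), (∀ γ, γ ∉ (units : Set G) → f γ = 0) ∧ f x = 1 ∧ (∀ γ, ‖f γ‖ ≤ 1) ∧
      ∀ y : UnitSpace G, f y ≠ 0 → y ∈ V := by
  -- Since `G⁽⁰⁾` is open in `G`, so is `V`; a bump function on `G` vanishing off `V` then
  -- automatically vanishes off the units.
  have hO : IsOpen (Subtype.val '' V : Set G) := isOpen_units.isOpenMap_subtype_val _ hV
  obtain ⟨φ, h1, h0, hc, hI⟩ := exists_continuous_one_zero_of_isCompact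
    (isCompact_singleton (x := (x : G))) hO.isClosed_compl
    (Set.disjoint_singleton_left.2 fun h => h ⟨x, hx, rfl⟩)
  refine ⟨⟨⟨fun γ => (φ γ : ℂ), by fun_prop⟩,
    hc.comp_left (g := ((↑) : ℝ → ℂ)) Complex.ofReal_zero⟩, ?_, ?_, ?_, ?_⟩
  · intro γ hγ
    have : φ γ = 0 := h0 fun ⟨y, _, hy⟩ => hγ (hy ▸ y.2)
    simp [this]
  · have : φ x = 1 := h1 rfl
    simp [this]
  · intro γ
    have := hI γ
    simpa [abs_of_nonneg this.1] using this.2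
  · intro y hy
    by_contra hyV
    have : φ y = 0 := h0 fun ⟨z, hz, hzy⟩ => hyV (Subtype.ext hzy ▸ hz)
    exact hy (by simp [this])

/-- Compressing `k` by functions on `G⁽⁰⁾` concentrated near `r γ` and `d γ` makes its norm at
most `‖k γ‖ + ε`, provided that `γ` is the only arrow from `d γ` to `r γ`. -/
theorem exists_norm_compression_le (k : C_c(G, ℂ)) (γ : G)
    (hγ : ∀ β : G, d β = d γ → r β = r γ → β = γ) {ε : ℝ} (hε : 0 < ε) :
    ∃ f g : C_c(G, ℂ), (∀ γ, γ ∉ (units : Set G) → f γ = 0) ∧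
      (∀ γ, γ ∉ (units : Set G) → g γ = 0) ∧ f (r γ) = 1 ∧ g (d γ) = 1 ∧
      ‖ofCc f * ofCc k * ofCc g‖ ≤ ‖k γ‖ + ε := by
  obtain ⟨U₀, hU₀, hγU₀, hd, hr⟩ := exists_open_bisection γ
  set U := U₀ ∩ {β | ‖k β‖ < ‖k γ‖ + ε} with hUdef
  have hU : IsOpen U := hU₀.inter (isOpen_lt k.continuous.norm continuous_const)
  have hγU : γ ∈ U := ⟨hγU₀, by simpa using hε⟩
  have hp : Continuous fun β : G => (r β, d β) := continuous_r.prodMk continuous_d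
  -- The part of the support outside `U` is compact, and by uniqueness of `γ` its image under `(r,
  -- d)` misses `(r γ, d γ)`. Hence a product neighbourhood `V ×ˢ W` of that point avoids the image,
  -- and bumps on `V` and `W` cut this part away.
  have hK : IsClosed ((fun β : G => (r β, d β)) '' (tsupport k \ U)) :=
    ((k.hasCompactSupport.isCompact.diff hU).image hp).isClosed
  have hnot : (r γ, d γ) ∈ ((fun β : G => (r β, d β)) '' (tsupport k \ U))ᶜ := by
    rintro ⟨β, ⟨-, hβU⟩, hβ⟩
    rw [hγ β (Prod.ext_iff.1 hβ).2 (Prod.ext_iff.1 hβ).1] at hβU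
    exact hβU hγU
  obtain ⟨V, W, hV, hW, hrV, hdW, hVW⟩ := isOpen_prod_iff.1 hK.isOpen_compl _ _ hnot
  obtain ⟨f, hf, hf1, hfle, hfV⟩ := exists_bump_units (r γ) hV hrV
  obtain ⟨g, hg, hg1, hgle, hgW⟩ := exists_bump_units (d γ) hW hdW
  refine ⟨f, g, hf, hg, hf1, hg1, ?_⟩
  have hval (β : G) : convolution (convolution f k) g β = f (r β) * k β * g (d β) :=
    (convolutionFun_units_right hg _ β).trans
      (congrArg (· * g (d β)) (convolutionFun_units_left hf k β))
  have hsupp (β : G) (hβ : convolution (convolution f k) g β ≠ 0) : β ∈ U := by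
    rw [hval] at hβ
    by_contra hβU
    have h1 := left_ne_zero_of_mul hβ
    exact hVW ⟨hfV _ (left_ne_zero_of_mul h1), hgW _ (right_ne_zero_of_mul hβ)⟩
      ⟨β, ⟨subset_tsupport k (right_ne_zero_of_mul h1), hβU⟩, rfl⟩
  rw [← ofCc_convolution, ← ofCc_convolution]
  refine norm_ofCc_le_of_bisection (by positivity) (hd.mono Set.inter_subset_left)
    (hr.mono Set.inter_subset_left) hsupp fun β => ?_
  by_cases hβ : convolution (convolution f k) g β = 0
  · rw [hβ, norm_zero]
    positivity
  · rw [hval, norm_mul, norm_mul]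
    calc ‖f (r β)‖ * ‖k β‖ * ‖g (d β)‖ ≤ 1 * ‖k β‖ * 1 := by
          gcongr
          · exact hfle _
          · exact hgle _
      _ = ‖k β‖ := by ring
      _ ≤ ‖k γ‖ + ε := (hsupp β hβ).2.le

/-! ### Automorphisms fixing the functions on the unit space -/

theorem ofCc_mem_unitSpaceAlgebra {f : C_c(G, ℂ)} (hf : ∀ γ, γ ∉ (units : Set G) → f γ = 0) :
    ofCc f ∈ unitSpaceAlgebra G :=
  subset_closure ⟨f, hf, rfl⟩

/-- Compressing by `f` and `g` with `f(r γ) = g(d γ) = 1` does not change the coefficient at `γ`,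
and `φ` commutes with the compression because it fixes `f` and `g`. As `φ` is isometric, the
coefficient of `φ(k)` is bounded by the norm of the compression of `k` itself, which can be made at
most `|k γ| + ε`. -/
theorem norm_coeff_apply_le {φ : ReducedCStarAlgebra G ≃⋆ₐ[ℂ] ReducedCStarAlgebra G}
    (hφ : ∀ a ∈ unitSpaceAlgebra G, φ a = a) {γ : G}
    (hγ : ∀ β : G, d β = d γ → r β = r γ → β = γ) (a : ReducedCStarAlgebra G) :
    ‖coeff γ (φ a)‖ ≤ ‖coeff γ a‖ := by
  refine denseRange_ofCc.induction_on a (isClosed_le ?_ (coeff γ).continuous.norm) fun k => ?_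
  · exact ((coeff γ).continuous.comp (StarAlgEquiv.isometry φ).continuous).norm
  refine le_of_forall_pos_le_add fun ε hε => ?_
  obtain ⟨f, g, hf, hg, hf1, hg1, hle⟩ := exists_norm_compression_le k γ hγ hε
  have hmul : φ (ofCc f * ofCc k * ofCc g) = ofCc f * φ (ofCc k) * ofCc g := by
    rw [map_mul, map_mul, hφ _ (ofCc_mem_unitSpaceAlgebra hf),
      hφ _ (ofCc_mem_unitSpaceAlgebra hg)]
  calc ‖coeff γ (φ (ofCc k))‖ = ‖coeff γ (φ (ofCc f * ofCc k * ofCc g))‖ := by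
        rw [hmul, coeff_mul_mul hf hg, hf1, hg1, one_mul, mul_one]
    _ ≤ ‖φ (ofCc f * ofCc k * ofCc g)‖ := norm_coeff_le _ _
    _ = ‖ofCc f * ofCc k * ofCc g‖ := StarAlgEquiv.norm_map φ _
    _ ≤ ‖coeff γ (ofCc k)‖ + ε := by rwa [coeff_ofCc]

/-- At an arrow which is determined by its domain and range, an automorphism of `C*_r(G)` that
fixes `C_0(G⁽⁰⁾)` acts as multiplication by a scalar. -/
theorem exists_coeff_apply_eq_mul {φ : ReducedCStarAlgebra G ≃⋆ₐ[ℂ] ReducedCStarAlgebra G}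
    (hφ : ∀ a ∈ unitSpaceAlgebra G, φ a = a) {γ : G}
    (hγ : ∀ β : G, d β = d γ → r β = r γ → β = γ) :
    ∃ c : ℂ, ∀ a, coeff γ (φ a) = c * coeff γ a := by
  have hker (a : ReducedCStarAlgebra G) (ha : coeff γ a = 0) : coeff γ (φ a) = 0 :=
    norm_le_zero_iff.1 ((norm_coeff_apply_le hφ hγ a).trans_eq (by rw [ha, norm_zero]))
  by_cases h : ∃ b, coeff γ b ≠ 0
  · obtain ⟨b, hb⟩ := h
    refine ⟨coeff γ (φ b) / coeff γ b, fun a => ?_⟩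
    -- Two functionals with nested kernels are proportional: `a` is corrected by a multiple of `b`
    -- to land in the kernel of `coeff γ`.
    have := hker (a - (coeff γ a / coeff γ b) • b) (by simp [hb])
    rw [map_sub, map_smul, map_sub, map_smul, smul_eq_mul, sub_eq_zero] at this
    rw [this]
    ring
  · push Not at h
    exact ⟨0, fun a => by rw [h, h, mul_zero]⟩

/-- For topologically principal `G`, automorphisms of `C*_r(G)` fixing `C_0(G⁽⁰⁾)` commute. -/
theorem commute_of_fix_unitSpaceAlgebra (hG : IsTopologicallyPrincipal G)
    {φ ψ : ReducedCStarAlgebra G ≃⋆ₐ[ℂ] ReducedCStarAlgebra G}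
    (hφ : ∀ a ∈ unitSpaceAlgebra G, φ a = a) (hψ : ∀ a ∈ unitSpaceAlgebra G, ψ a = a)
    (a : ReducedCStarAlgebra G) : φ (ψ a) = ψ (φ a) := by
  -- The preimage of a dense set under the open map `d` is dense, so by continuity only arrows whose
  -- domain has trivial isotropy need checking.
  refine ext_coeff fun γ => congrFun (Continuous.ext_on (hG.preimage isLocalHomeomorph_d.isOpenMap)
    (continuous_coeff (φ (ψ a))) (continuous_coeff (ψ (φ a))) fun γ hγ => ?_) γ
  have huniq := eq_of_d_eq_of_r_eq hγ
  obtain ⟨c, hc⟩ := exists_coeff_apply_eq_mul hφ huniq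
  obtain ⟨c', hc'⟩ := exists_coeff_apply_eq_mul hψ huniq
  show coeff γ (φ (ψ a)) = coeff γ (ψ (φ a))
  rw [hc, hc', hc', hc]
  ring

end Coefficients

end EtaleGroupoid

/-! ### Descent of the action to the topological abelianization -/

theorem mainTheorem6 {G : Type u} [TopologicalSpace G] [EtaleGroupoid G] [T2Space G]
    [LocallyCompactSpace G] (hG : EtaleGroupoid.IsTopologicallyPrincipal G)
    {H : Type v} [Group H] [TopologicalSpace H] [IsTopologicalGroup H]
    (σ : H →* (EtaleGroupoid.ReducedCStarAlgebra G ≃⋆ₐ[ℂ] EtaleGroupoid.ReducedCStarAlgebra G))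
    (hσ : IsClosed (σ.ker : Set H))
    (hfix : EtaleGroupoid.unitSpaceAlgebra G ⊆ fixedPointAlgebra σ) :
    ∃ τ : TopologicalAbelianization H →*
        (EtaleGroupoid.ReducedCStarAlgebra G ≃⋆ₐ[ℂ] EtaleGroupoid.ReducedCStarAlgebra G),
      ∀ s : H, σ s = τ (QuotientGroup.mk s) := by
  have hcomm (s t : H) : σ s * σ t = σ t * σ s :=
    StarAlgEquiv.ext fun a => EtaleGroupoid.commute_of_fix_unitSpaceAlgebra hG
      (fun b hb => hfix hb s) (fun b hb => hfix hb t) a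
  have hker : commutator H ≤ σ.ker := by
    rw [commutator_def, Subgroup.commutator_le]
    intro s _ t _
    rw [MonoidHom.mem_ker, map_commutatorElement, commutatorElement_eq_one_iff_mul_comm]
    exact hcomm s t
  -- The quotient is by the closure of the commutator subgroup; closedness of the kernel replaces
  -- any continuity of `σ`.
  exact ⟨QuotientGroup.lift _ σ (Subgroup.topologicalClosure_minimal _ hker hσ), fun s => rfl⟩
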